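/- Let $k,n\ge 0$ be integers and let $\mathbb L^{n+2}$ be $\mathbb R^{n+2}$ with coordinates $(t,x_1,\dots,x_{n+1})$ and the Lorentzian metric $\langle\,,\rangle=-dt^2+dx_1^2+\cdots+dx_{n+1}^2$. Let $J\subset\mathbb R$ be an open interval containing $0$ and let $r\in C^\infty(J)$ be admissible, that is, $r>0$ and $|r'|<1$ on $J$. Put $$Q(r)=\{(t,x)\in J\times\mathbb R^{n+1} : \|x\|^2=r(t)^2\}\subset\mathbb L^{n+2},$$ a Lorentzian hypersurface of $\mathbb L^{n+2}$. Let $M^k$ be a $k$-dimensional smooth manifold and let $\Psi=(\Psi_0,\Psi_1,\dots,\Psi_{n+1})\colon M^k\to\mathbb L^{n+2}$ be a spacelike immersion (a smooth immersion whose induced metric is Riemannian) with $\Psi_0(M)\subset J$. Let $\nabla$, $\Delta$ and $\|\cdot\|$ be the gradient, the Laplacian and the norm of the induced metric, $\Delta$ acting on $\Psi$ componentwise, and set $$\mathbf P=\big(r(\Psi_0)\,r'(\Psi_0),\Psi_1,\dots,\Psi_{n+1}\big),\qquad q_{\Psi_0}=\frac{k-\big(r''(\Psi_0)\,r(\Psi_0)+r'(\Psi_0)^2-1\big)\|\nabla\Psi_0\|^2}{r(\Psi_0)^2\,\big(1-r'(\Psi_0)^2\big)}.$$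 If $q_{\Psi_0}>0$ everywhere on $M$ and $$\Delta\Psi+q_{\Psi_0}\,\mathbf P=0,$$ then $\Psi(M)\subset Q(r)$, and $\Psi\colon M^k\to Q(r)$ is a stationary spacelike immersion, that is, its mean curvature vector field in $Q(r)$ vanishes identically. -/

import Mathlib

open scoped Manifold ContDiff

noncomputable section

namespace SphericalRW

/-! ### Lorentz-Minkowski spacetime and the rotation hypersurface

The Lorentz-Minkowski spacetime of dimension `n + 2` is the real vector space `Fin (n + 2) → ℝ`
with the bilinear form `lorentz`; only its topology and its linear structure are used besides. -/

/-- The Lorentzian product `-(dt)² + (dx₁)² + ⋯ + (dxₙ₊₁)²`; the coordinate `0` is the time. -/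
def lorentz {n : ℕ} (v w : Fin (n + 2) → ℝ) : ℝ :=
  -(v 0 * w 0) + ∑ i : Fin (n + 1), v i.succ * w i.succ

/-- Admissible functions: smooth functions `r` on an open interval `J` that contains `0`, with
`r > 0` and `|r'| < 1` on `J`. The values of `r` outside `J` play no role. -/
structure IsAdmissible (J : Set ℝ) (r : ℝ → ℝ) : Prop where
  isOpen : IsOpen J
  ordConnected : J.OrdConnected
  zero_mem : (0 : ℝ) ∈ J
  smooth : ContDiffOn ℝ ∞ r J
  pos : ∀ t ∈ J, 0 < r t
  abs_deriv_lt_one : ∀ t ∈ J, |deriv r t| < 1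

/-- The rotation hypersurface `Q(r) = {(t, x) : t ∈ J, ‖x‖² = r(t)²}`. -/
def rotationHypersurface (n : ℕ) (J : Set ℝ) (r : ℝ → ℝ) : Set (Fin (n + 2) → ℝ) :=
  {y | y 0 ∈ J ∧ ∑ i : Fin (n + 1), y i.succ ^ 2 = r (y 0) ^ 2}

/-- The vector field `(t, x) ↦ (r(t) r'(t), x)`. On `Q(r)` it is half of the Lorentzian gradient of
the defining function `‖x‖² - r(t)²`, so it is spacelike and spans the normal line of `Q(r)`, and
the tangent space of `Q(r)` at `(t, x)` is its Lorentzian orthogonal complement (see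
`lorentz_conormal_self_pos` and `lorentz_conormal_velocity`). -/
def conormal {n : ℕ} (r : ℝ → ℝ) (y : Fin (n + 2) → ℝ) : Fin (n + 2) → ℝ :=
  Fin.cons (r (y 0) * deriv r (y 0)) (fun i : Fin (n + 1) => y i.succ)

theorem lorentz_conormal_self_pos {n : ℕ} {J : Set ℝ} {r : ℝ → ℝ} (hr : IsAdmissible J r)
    {y : Fin (n + 2) → ℝ} (hy : y ∈ rotationHypersurface n J r) :
    0 < lorentz (conormal r y) (conormal r y) := by
  obtain ⟨h0, h1⟩ := hy
  have hp := hr.pos _ h0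
  have hd := (sq_lt_one_iff_abs_lt_one (deriv r (y 0))).2 (hr.abs_deriv_lt_one _ h0)
  have h2 : ∑ i : Fin (n + 1), y i.succ * y i.succ = r (y 0) ^ 2 := by
    rw [← h1]
    exact Finset.sum_congr rfl fun i _ => (sq (y i.succ)).symm
  simp only [lorentz, conormal, Fin.cons_zero, Fin.cons_succ, h2]
  nlinarith [mul_pos (pow_pos hp 2) (sub_pos.2 hd)]

theorem lorentz_conormal_velocity {n : ℕ} {J : Set ℝ} {r : ℝ → ℝ} (hr : IsAdmissible J r)
    {c : ℝ → Fin (n + 2) → ℝ} {v : Fin (n + 2) → ℝ} {s : ℝ} (hc : HasDerivAt c v s)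
    (hQ : ∀ s, c s ∈ rotationHypersurface n J r) : lorentz (conormal r (c s)) v = 0 := by
  have hcomp := hasDerivAt_pi.1 hc
  have hJ := (hQ s).1
  have hrd : HasDerivAt r (deriv r (c s 0)) (c s 0) :=
    (((hr.smooth.contDiffAt (hr.isOpen.mem_nhds hJ)).differentiableAt (by simp))).hasDerivAt
  have h1 := (hrd.comp s (hcomp 0)).pow 2
  have h2 : HasDerivAt (fun u => ∑ i : Fin (n + 1), c u i.succ ^ 2) _ s :=
    HasDerivAt.fun_sum fun i _ => (hcomp i.succ).pow 2
  have he : (fun u => ∑ i : Fin (n + 1), c u i.succ ^ 2) = (r ∘ fun u => c u 0) ^ 2 :=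
    funext fun u => (hQ u).2
  rw [he] at h2
  have h3 := h1.unique h2
  simp only [lorentz, conormal, Fin.cons_zero, Fin.cons_succ, Function.comp] at h3 ⊢
  have h4 : ∑ i : Fin (n + 1), ((2 : ℕ) : ℝ) * c s i.succ ^ (2 - 1) * v i.succ
      = 2 * ∑ i : Fin (n + 1), c s i.succ * v i.succ := by
    rw [Finset.mul_sum]
    exact Finset.sum_congr rfl fun i _ => by norm_num; ring
  rw [h4] at h3
  norm_num at h3
  linarith

/-- Lorentzian orthogonal projection onto the tangent space of `Q(r)` at the point `y`. The
Levi-Civita connection of `Q(r)` is the projection of the flat connection. -/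
def tangentProj {n : ℕ} (r : ℝ → ℝ) (y w : Fin (n + 2) → ℝ) : Fin (n + 2) → ℝ :=
  w - (lorentz w (conormal r y) / lorentz (conormal r y) (conormal r y)) • conormal r y

/-! ### Riemannian geometry in local coordinates

Below `G` is the matrix of a Riemannian metric in the coordinates of an open set of `ℝᵏ`. -/

section Coordinates

variable {k : ℕ} {V : Type*} [NormedAddCommGroup V] [NormedSpace ℝ V]

/-- The partial derivative `∂ᵢ u` at `x`. -/
def pd (i : Fin k) (u : EuclideanSpace ℝ (Fin k) → V) (x : EuclideanSpace ℝ (Fin k)) : V :=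
  fderiv ℝ u x (EuclideanSpace.single i 1)

/-- The Christoffel symbols `Γˡᵢⱼ` of the Levi-Civita connection of the metric `G`. -/
def christoffel (G : EuclideanSpace ℝ (Fin k) → Matrix (Fin k) (Fin k) ℝ) (l i j : Fin k)
    (x : EuclideanSpace ℝ (Fin k)) : ℝ :=
  (1 / 2) * ∑ m : Fin k, (G x)⁻¹ l m *
    (pd i (fun y => G y j m) x + pd j (fun y => G y i m) x - pd m (fun y => G y i j) x)

/-- The Laplace-Beltrami operator `gⁱʲ (∂ᵢ∂ⱼu - Γˡᵢⱼ ∂ₗu)` (the trace of the Hessian) of the metric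
`G`, on functions with values in a vector space. -/
def coordLaplacian (G : EuclideanSpace ℝ (Fin k) → Matrix (Fin k) (Fin k) ℝ)
    (u : EuclideanSpace ℝ (Fin k) → V) (x : EuclideanSpace ℝ (Fin k)) : V :=
  ∑ i : Fin k, ∑ j : Fin k, (G x)⁻¹ i j •
    (pd i (pd j u) x - ∑ l : Fin k, christoffel G l i j x • pd l u x)

/-- The squared norm `gⁱʲ ∂ᵢu ∂ⱼu` of the gradient with respect to the metric `G`. -/
def coordGradSq (G : EuclideanSpace ℝ (Fin k) → Matrix (Fin k) (Fin k) ℝ)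
    (u : EuclideanSpace ℝ (Fin k) → ℝ) (x : EuclideanSpace ℝ (Fin k)) : ℝ :=
  ∑ i : Fin k, ∑ j : Fin k, (G x)⁻¹ i j * (pd i u x * pd j u x)

variable {n : ℕ}

/-- The matrix `gᵢⱼ = ⟨∂ᵢF, ∂ⱼF⟩` of the metric induced by `F` from Lorentz-Minkowski spacetime. -/
def coordMetric (F : EuclideanSpace ℝ (Fin k) → Fin (n + 2) → ℝ)
    (x : EuclideanSpace ℝ (Fin k)) : Matrix (Fin k) (Fin k) ℝ :=
  Matrix.of fun i j => lorentz (pd i F x) (pd j F x)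

/-- Lorentzian orthogonal projection onto the orthogonal complement of the tangent space of the
immersion `F`, spanned by `∂₁F, …, ∂ₖF`. -/
def normalProj (F : EuclideanSpace ℝ (Fin k) → Fin (n + 2) → ℝ)
    (x : EuclideanSpace ℝ (Fin k)) (w : Fin (n + 2) → ℝ) : Fin (n + 2) → ℝ :=
  w - ∑ i : Fin k, ∑ j : Fin k, ((coordMetric F x)⁻¹ i j * lorentz w (pd j F x)) • pd i F x

/-- The second fundamental form of the immersion `F` into `Q(r)`, evaluated at `∂ᵢ, ∂ⱼ`: the
component normal to the immersion of the covariant derivative, in `Q(r)`, of `∂ⱼF` along `∂ᵢ`. -/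
def coordSecondFundamentalForm (r : ℝ → ℝ) (F : EuclideanSpace ℝ (Fin k) → Fin (n + 2) → ℝ)
    (i j : Fin k) (x : EuclideanSpace ℝ (Fin k)) : Fin (n + 2) → ℝ :=
  normalProj F x (tangentProj r (F x) (pd i (pd j F) x))

/-- The mean curvature vector field `(1 / k) gⁱʲ σ(∂ᵢ, ∂ⱼ)` of the immersion `F` into `Q(r)`. -/
def coordMeanCurvature (r : ℝ → ℝ) (F : EuclideanSpace ℝ (Fin k) → Fin (n + 2) → ℝ)
    (x : EuclideanSpace ℝ (Fin k)) : Fin (n + 2) → ℝ :=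
  (k : ℝ)⁻¹ • ∑ i : Fin k, ∑ j : Fin k,
    (coordMetric F x)⁻¹ i j • coordSecondFundamentalForm r F i j x

end Coordinates

/-! ### Spacelike immersions

The quantities below do not depend on the coordinates; at `p` they are computed in the preferred
chart at `p`. The manifold `M` carries the metric induced by the spacelike immersion `Ψ`. -/

section Manifold

variable {k n : ℕ} {M : Type*} [TopologicalSpace M] [ChartedSpace (EuclideanSpace ℝ (Fin k)) M]

/-- The expression of `u` in the preferred chart at `p`. -/
def inChart {V : Type*} (p : M) (u : M → V) : EuclideanSpace ℝ (Fin k) → V :=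
  u ∘ (extChartAt (𝓡 k) p).symm

/-- A smooth map whose induced symmetric form on each tangent space is positive definite (in
particular its differential is injective). -/
structure IsSpacelikeImmersion (Ψ : M → Fin (n + 2) → ℝ) : Prop where
  smooth : ContMDiff (𝓡 k) 𝓘(ℝ, Fin (n + 2) → ℝ) ∞ Ψ
  spacelike : ∀ (p : M) (v : TangentSpace (𝓡 k) p), v ≠ 0 →
    0 < lorentz (n := n) (mfderiv (𝓡 k) 𝓘(ℝ, Fin (n + 2) → ℝ) Ψ p v)
      (mfderiv (𝓡 k) 𝓘(ℝ, Fin (n + 2) → ℝ) Ψ p v)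

/-- The Laplacian `Δu` of the metric induced by `Ψ`. -/
def laplacian {V : Type*} [NormedAddCommGroup V] [NormedSpace ℝ V]
    (Ψ : M → Fin (n + 2) → ℝ) (u : M → V) (p : M) : V :=
  coordLaplacian (coordMetric (inChart p Ψ)) (inChart p u) (extChartAt (𝓡 k) p p)

/-- The squared norm `‖∇u‖²` of the gradient for the metric induced by `Ψ`. -/
def gradSq (Ψ : M → Fin (n + 2) → ℝ) (u : M → ℝ) (p : M) : ℝ :=
  coordGradSq (coordMetric (inChart p Ψ)) (inChart p u) (extChartAt (𝓡 k) p p)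

/-- The function
`q = (k - (r''(Ψ₀) r(Ψ₀) + r'(Ψ₀)² - 1) ‖∇Ψ₀‖²) / (r(Ψ₀)² (1 - r'(Ψ₀)²))`. -/
def qFun (r : ℝ → ℝ) (Ψ : M → Fin (n + 2) → ℝ) (p : M) : ℝ :=
  ((k : ℝ) - (deriv (deriv r) (Ψ p 0) * r (Ψ p 0) + deriv r (Ψ p 0) ^ 2 - 1) *
      gradSq (k := k) Ψ (fun x => Ψ x 0) p) /
    (r (Ψ p 0) ^ 2 * (1 - deriv r (Ψ p 0) ^ 2))

/-- The mean curvature vector field of `Ψ` as an immersion into `Q(r)`. -/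
def meanCurvature (r : ℝ → ℝ) (Ψ : M → Fin (n + 2) → ℝ) (p : M) : Fin (n + 2) → ℝ :=
  coordMeanCurvature r (inChart p Ψ) (extChartAt (𝓡 k) p p)

/-- `Ψ` is a stationary spacelike immersion into `Q(r)`: a spacelike immersion with values in `Q(r)`
whose mean curvature vector field in `Q(r)` vanishes. -/
structure IsStationaryInto (J : Set ℝ) (r : ℝ → ℝ) (Ψ : M → Fin (n + 2) → ℝ) : Prop where
  isSpacelikeImmersion : IsSpacelikeImmersion (k := k) Ψ
  mapsTo : ∀ p, Ψ p ∈ rotationHypersurface n J r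
  meanCurvature_eq_zero : ∀ p, meanCurvature (k := k) r Ψ p = 0

end Manifold

end SphericalRW

end

/-! Write `P` for `conormal r Ψ`. The Laplacian of an isometric immersion into a flat space is
normal to it (`lorentz_coordLaplacian_pd`, from the Koszul formula). As `q ≠ 0`, the equation makes
`P` normal to `Ψ` as well, before anything is known about `Q(r)`. Differentiating `⟨P, ∂ⱼΨ⟩ = 0` and
taking the trace (`lorentz_coordLaplacian_conormal`) gives `⟨ΔΨ, P⟩ = (r''r + r'² - 1)‖∇Ψ₀‖² - k`,
which is `-q r²(1 - r'²)` by the choice of `q`. The equation itself gives `⟨ΔΨ, P⟩ = -q⟨P, P⟩`.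
Cancelling `q` leaves `⟨P, P⟩ = r²(1 - r'²)`, that is, `‖x‖² = r²`. The argument is pointwise, so no
connectedness of `M` or constant of integration enters. Once `Ψ` lies in `Q(r)`, `P` is normal to
`Q(r)`, so the part of `ΔΨ` tangent to `Q(r)` is zero; this forces the mean curvature to vanish
(`coordMeanCurvature_eq_zero`). -/

namespace SphericalRW

/-! ### Linear algebra of the Lorentzian product -/

section LorentzAlgebra

variable {n : ℕ}

theorem lorentz_comm (v w : Fin (n + 2) → ℝ) : lorentz v w = lorentz w v := by
  simp only [lorentz, mul_comm]

/-- The Lorentzian product as a bilinear form. -/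
noncomputable def lorentzForm (n : ℕ) : (Fin (n + 2) → ℝ) →ₗ[ℝ] (Fin (n + 2) → ℝ) →ₗ[ℝ] ℝ :=
  LinearMap.mk₂ ℝ lorentz
    (fun u v w => by
      simp only [lorentz, Pi.add_apply, add_mul, Finset.sum_add_distrib]; ring)
    (fun c v w => by
      simp only [lorentz, Pi.smul_apply, smul_eq_mul, mul_add, Finset.mul_sum, mul_assoc]; ring)
    (fun u v w => by
      simp only [lorentz, Pi.add_apply, mul_add, Finset.sum_add_distrib]; ring)
    (fun c v w => by
      simp only [lorentz, Pi.smul_apply, smul_eq_mul, mul_add, Finset.mul_sum, mul_left_comm _ c]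
      ring)

theorem lorentz_eq_lorentzForm (v w : Fin (n + 2) → ℝ) : lorentz v w = lorentzForm n v w := rfl

/-- Lorentzian orthogonal projection onto the tangent space of `Q(r)`, as a linear map. -/
noncomputable def tangentProjLinear (r : ℝ → ℝ) (y : Fin (n + 2) → ℝ) :
    (Fin (n + 2) → ℝ) →ₗ[ℝ] (Fin (n + 2) → ℝ) :=
  LinearMap.id - ((lorentz (conormal r y) (conormal r y))⁻¹ •
    (lorentzForm n).flip (conormal r y)).smulRight (conormal r y)

theorem tangentProj_eq (r : ℝ → ℝ) (y w : Fin (n + 2) → ℝ) :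
    tangentProj r y w = tangentProjLinear r y w := by
  simp [tangentProj, tangentProjLinear, lorentz_eq_lorentzForm, div_eq_inv_mul]

theorem tangentProj_conormal {r : ℝ → ℝ} {y : Fin (n + 2) → ℝ}
    (h : lorentz (conormal r y) (conormal r y) ≠ 0) : tangentProj r y (conormal r y) = 0 := by
  simp [tangentProj, div_self h]

theorem tangentProj_of_orthogonal {r : ℝ → ℝ} {y w : Fin (n + 2) → ℝ}
    (h : lorentz (conormal r y) w = 0) : tangentProj r y w = w := by
  simp [tangentProj, lorentz_comm w, h]

end LorentzAlgebra

/-! ### Coordinate calculus and the induced metric -/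

section Coordinates

variable {k n : ℕ}

theorem pd_apply {F : EuclideanSpace ℝ (Fin k) → Fin (n + 2) → ℝ} {x : EuclideanSpace ℝ (Fin k)}
    (hF : DifferentiableAt ℝ F x) (i : Fin k) (a : Fin (n + 2)) :
    pd i (fun y => F y a) x = pd i F x a := by
  simp only [pd]
  rw [fderiv_apply hF]
  rfl

theorem pd_lorentz {u v : EuclideanSpace ℝ (Fin k) → Fin (n + 2) → ℝ}
    {x : EuclideanSpace ℝ (Fin k)} (hu : DifferentiableAt ℝ u x) (hv : DifferentiableAt ℝ v x)
    (i : Fin k) :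
    pd i (fun y => lorentz (u y) (v y)) x = lorentz (pd i u x) (v x) + lorentz (u x) (pd i v x) := by
  have hu' := hasFDerivAt_pi'.1 hu.hasFDerivAt
  have hv' := hasFDerivAt_pi'.1 hv.hasFDerivAt
  have h := ((hu' 0).mul (hv' 0)).neg.add
    (HasFDerivAt.fun_sum (u := Finset.univ)
      fun (s : Fin (n + 1)) _ => (hu' s.succ).mul (hv' s.succ))
  have h' : pd i (fun y => lorentz (u y) (v y)) x = _ :=
    congrArg (fun L => L (EuclideanSpace.single i (1 : ℝ))) h.fderiv
  rw [h']
  simp [lorentz, pd, Finset.sum_add_distrib, mul_comm]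
  ring

theorem pd_differentiableAt {V : Type*} [NormedAddCommGroup V] [NormedSpace ℝ V]
    {F : EuclideanSpace ℝ (Fin k) → V} {x : EuclideanSpace ℝ (Fin k)}
    (hF : ContDiffAt ℝ 2 F x) (i : Fin k) : DifferentiableAt ℝ (pd i F) x :=
  ((hF.fderiv_right (m := 1) (by norm_num)).differentiableAt one_ne_zero).clm_apply
    (differentiableAt_const _)

theorem pd_pd_comm {V : Type*} [NormedAddCommGroup V] [NormedSpace ℝ V]
    {F : EuclideanSpace ℝ (Fin k) → V} {x : EuclideanSpace ℝ (Fin k)}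
    (hF : ContDiffAt ℝ 2 F x) (i j : Fin k) : pd i (pd j F) x = pd j (pd i F) x := by
  have hd : DifferentiableAt ℝ (fderiv ℝ F) x :=
    (hF.fderiv_right (m := 1) (by norm_num)).differentiableAt one_ne_zero
  have key : ∀ i j : Fin k, pd i (pd j F) x
      = fderiv ℝ (fderiv ℝ F) x (EuclideanSpace.single i 1) (EuclideanSpace.single j 1) := by
    intro i j
    have : HasFDerivAt (fun y => fderiv ℝ F y (EuclideanSpace.single j 1)) _ x :=
      hd.hasFDerivAt.clm_apply (hasFDerivAt_const _ x)
    change fderiv ℝ (fun y => fderiv ℝ F y (EuclideanSpace.single j 1)) x _ = _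
    rw [this.fderiv]
    simp
  rw [key, key]
  exact (hF.isSymmSndFDerivAt (by simp)).eq _ _

theorem fderiv_eq_sum_pd {V : Type*} [NormedAddCommGroup V] [NormedSpace ℝ V]
    (F : EuclideanSpace ℝ (Fin k) → V) (x v : EuclideanSpace ℝ (Fin k)) :
    fderiv ℝ F x v = ∑ i, v i • pd i F x := by
  have hv : v = ∑ i, v i • EuclideanSpace.single i (1 : ℝ) := by
    ext j
    simp [Finset.sum_apply, Pi.single_apply]
  conv_lhs => rw [hv]
  simp [pd]

/-- A Lorentzian form may degenerate on a subspace, so positivity is essential: a null vector `v` of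
the Gram matrix would satisfy `⟨dF v, dF v⟩ = 0`. -/
theorem coordMetric_isUnit_det {F : EuclideanSpace ℝ (Fin k) → Fin (n + 2) → ℝ}
    {x : EuclideanSpace ℝ (Fin k)}
    (h : ∀ v, v ≠ 0 → 0 < lorentz (fderiv ℝ F x v) (fderiv ℝ F x v)) :
    IsUnit (coordMetric F x).det := by
  rw [isUnit_iff_ne_zero]
  intro hdet
  obtain ⟨v, hv0, hv⟩ := Matrix.exists_mulVec_eq_zero_iff.2 hdet
  have hpos := h (WithLp.toLp 2 v) (by simpa using hv0)
  refine hpos.ne' ?_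
  rw [fderiv_eq_sum_pd]
  simp only [lorentz_eq_lorentzForm, map_sum, LinearMap.sum_apply, map_smul, LinearMap.smul_apply]
  refine Finset.sum_eq_zero fun i _ => ?_
  have hi := congrFun hv i
  simp only [Matrix.mulVec, dotProduct, coordMetric, Matrix.of_apply, Pi.zero_apply,
    lorentz_eq_lorentzForm] at hi
  rw [← smul_zero (v i), ← hi]
  refine congrArg _ (Finset.sum_congr rfl fun j _ => ?_)
  rw [← lorentz_eq_lorentzForm, ← lorentz_eq_lorentzForm, lorentz_comm, smul_eq_mul, mul_comm]

/-- The Koszul formula: the second derivatives of an immersion have the tangential components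
given by the Christoffel symbols of the induced metric. -/
theorem sum_christoffel_mul_coordMetric {F : EuclideanSpace ℝ (Fin k) → Fin (n + 2) → ℝ}
    {x : EuclideanSpace ℝ (Fin k)} (hF : ContDiffAt ℝ 2 F x)
    (hG : IsUnit (coordMetric F x).det) (i j m : Fin k) :
    ∑ l, christoffel (coordMetric F) l i j x * coordMetric F x l m
      = lorentz (pd i (pd j F) x) (pd m F x) := by
  have hd := pd_differentiableAt hF
  have hsymm : ∀ a b, coordMetric F x a b = coordMetric F x b a := fun a b => lorentz_comm _ _
  have hp : ∀ a b c, pd a (fun y => coordMetric F y b c) x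
      = lorentz (pd a (pd b F) x) (pd c F x) + lorentz (pd b F x) (pd a (pd c F) x) :=
    fun a b c => pd_lorentz (hd b) (hd c) a
  have hinv := Matrix.mul_nonsing_inv _ hG
  -- By symmetry of second derivatives, four of the six terms cancel and the other two agree.
  have hK : ∀ s, pd i (fun y => coordMetric F y j s) x + pd j (fun y => coordMetric F y i s) x
      - pd s (fun y => coordMetric F y i j) x = 2 * lorentz (pd i (pd j F) x) (pd s F x) := by
    intro s
    rw [hp, hp, hp, pd_pd_comm hF j i, pd_pd_comm hF s i, pd_pd_comm hF s j,
      lorentz_comm (pd i (pd s F) x)]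
    ring
  simp only [christoffel, hK]
  have hδ : ∀ s, ∑ l, coordMetric F x m l * (coordMetric F x)⁻¹ l s
      = (1 : Matrix (Fin k) (Fin k) ℝ) m s := by
    intro s
    rw [← hinv, Matrix.mul_apply]
  calc _ = ∑ l, ∑ s, (coordMetric F x m l * (coordMetric F x)⁻¹ l s) *
        lorentz (pd i (pd j F) x) (pd s F x) := by
        refine Finset.sum_congr rfl fun l _ => ?_
        rw [Finset.mul_sum, Finset.sum_mul]
        refine Finset.sum_congr rfl fun s _ => ?_
        rw [hsymm l m]; ring
    _ = _ := by
        rw [Finset.sum_comm]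
        simp only [← Finset.sum_mul, hδ, Matrix.one_apply, ite_mul, one_mul, zero_mul,
          Finset.sum_ite_eq, Finset.mem_univ, if_true]

theorem lorentz_coordLaplacian {F : EuclideanSpace ℝ (Fin k) → Fin (n + 2) → ℝ}
    (G : EuclideanSpace ℝ (Fin k) → Matrix (Fin k) (Fin k) ℝ) (x : EuclideanSpace ℝ (Fin k))
    (w : Fin (n + 2) → ℝ) :
    lorentz (coordLaplacian G F x) w = ∑ i, ∑ j, (G x)⁻¹ i j *
      (lorentz (pd i (pd j F) x) w - ∑ l, christoffel G l i j x * lorentz (pd l F x) w) := by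
  simp only [coordLaplacian, lorentz_eq_lorentzForm, map_sum, LinearMap.sum_apply, map_smul,
    LinearMap.smul_apply, map_sub, LinearMap.sub_apply, smul_eq_mul]

/-- The Laplacian of an immersion, for the induced metric, is normal to it. -/
theorem lorentz_coordLaplacian_pd {F : EuclideanSpace ℝ (Fin k) → Fin (n + 2) → ℝ}
    {x : EuclideanSpace ℝ (Fin k)} (hF : ContDiffAt ℝ 2 F x)
    (hG : IsUnit (coordMetric F x).det) (m : Fin k) :
    lorentz (coordLaplacian (coordMetric F) F x) (pd m F x) = 0 := by
  rw [lorentz_coordLaplacian]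
  refine Finset.sum_eq_zero fun i _ => Finset.sum_eq_zero fun j _ => ?_
  rw [← sum_christoffel_mul_coordMetric hF hG i j m]
  exact mul_eq_zero_of_right _ (sub_self _)

/-- The trace of the identity matrix; this is the source of the term `k` in `q`. -/
theorem sum_inv_mul_coordMetric {F : EuclideanSpace ℝ (Fin k) → Fin (n + 2) → ℝ}
    {x : EuclideanSpace ℝ (Fin k)} (hG : IsUnit (coordMetric F x).det) :
    ∑ i, ∑ j, (coordMetric F x)⁻¹ i j * coordMetric F x i j = k := by
  have hsymm : ∀ a b, coordMetric F x a b = coordMetric F x b a := fun a b => lorentz_comm _ _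
  have h := congrArg Matrix.trace (Matrix.nonsing_inv_mul _ hG)
  rw [Matrix.trace_one, Fintype.card_fin] at h
  simp only [Matrix.trace, Matrix.diag_apply, Matrix.mul_apply] at h
  simpa only [fun i j => hsymm j i] using h

/-- `normalProj` as a linear map. -/
noncomputable def normalProjLinear (F : EuclideanSpace ℝ (Fin k) → Fin (n + 2) → ℝ)
    (x : EuclideanSpace ℝ (Fin k)) : (Fin (n + 2) → ℝ) →ₗ[ℝ] (Fin (n + 2) → ℝ) :=
  LinearMap.id - ∑ i : Fin k, ∑ j : Fin k, ((coordMetric F x)⁻¹ i j •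
    (lorentzForm n).flip (pd j F x)).smulRight (pd i F x)

theorem normalProj_eq (F : EuclideanSpace ℝ (Fin k) → Fin (n + 2) → ℝ)
    (x : EuclideanSpace ℝ (Fin k)) (w : Fin (n + 2) → ℝ) :
    normalProj F x w = normalProjLinear F x w := by
  simp [normalProj, normalProjLinear, lorentz_eq_lorentzForm, LinearMap.sum_apply]

theorem normalProj_pd {F : EuclideanSpace ℝ (Fin k) → Fin (n + 2) → ℝ}
    {x : EuclideanSpace ℝ (Fin k)} (hG : IsUnit (coordMetric F x).det) (l : Fin k) :
    normalProj F x (pd l F x) = 0 := by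
  have hδ : ∀ i, ∑ j, (coordMetric F x)⁻¹ i j * lorentz (pd l F x) (pd j F x)
      = (1 : Matrix (Fin k) (Fin k) ℝ) i l := by
    intro i
    rw [← Matrix.nonsing_inv_mul _ hG, Matrix.mul_apply]
    exact Finset.sum_congr rfl fun j _ => by rw [lorentz_comm]; rfl
  simp only [normalProj, ← Finset.sum_smul, hδ, Matrix.one_apply, ite_smul, one_smul, zero_smul,
    Finset.sum_ite_eq', Finset.mem_univ, if_true, sub_self]

/-- The mean curvature in `Q(r)` vanishes if the Laplacian is a multiple of the conormal. -/
theorem coordMeanCurvature_eq_zero {r : ℝ → ℝ} {F : EuclideanSpace ℝ (Fin k) → Fin (n + 2) → ℝ}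
    {x : EuclideanSpace ℝ (Fin k)} (hG : IsUnit (coordMetric F x).det)
    (hP : lorentz (conormal r (F x)) (conormal r (F x)) ≠ 0)
    (ht : ∀ l, lorentz (conormal r (F x)) (pd l F x) = 0) {c : ℝ}
    (hΔ : coordLaplacian (coordMetric F) F x = c • conormal r (F x)) :
    coordMeanCurvature r F x = 0 := by
  -- `T` kills each `∂ₗF`, hence the Christoffel terms of the Laplacian, so `T` of the Laplacian is
  -- the trace of the second fundamental form. It also kills the conormal.
  let T := (normalProjLinear F x).comp (tangentProjLinear r (F x))
  have hσ : ∀ i j, coordSecondFundamentalForm r F i j x = T (pd i (pd j F) x) := fun i j => by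
    simp [coordSecondFundamentalForm, T, tangentProj_eq, normalProj_eq]
  have hT : ∀ l, T (pd l F x) = 0 := fun l => by
    simp only [T, LinearMap.comp_apply, ← tangentProj_eq, ← normalProj_eq]
    rw [tangentProj_of_orthogonal (ht l), normalProj_pd hG]
  have hTP : T (conormal r (F x)) = 0 := by
    simp only [T, LinearMap.comp_apply, ← tangentProj_eq]
    rw [tangentProj_conormal hP, map_zero]
  have h := congrArg T hΔ
  simp only [coordLaplacian, map_sum, map_smul, map_sub, hT, hTP, smul_zero, Finset.sum_const_zero,
    sub_zero] at h
  simp only [coordMeanCurvature, hσ, h, smul_zero]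

/-! ### The conormal along an immersion -/

theorem hasDerivAt_mul_deriv {J : Set ℝ} {r : ℝ → ℝ} (hr : IsAdmissible J r) {t : ℝ}
    (ht : t ∈ J) :
    HasDerivAt (fun s => r s * deriv r s) (deriv r t * deriv r t + r t * deriv (deriv r) t) t := by
  have h := hr.smooth.contDiffAt (hr.isOpen.mem_nhds ht)
  have h1 : DifferentiableAt ℝ r t := h.differentiableAt (by simp)
  have h2 : DifferentiableAt ℝ (deriv r) t := by
    have : ContDiffAt ℝ 1 (fderiv ℝ r) t := h.fderiv_right (m := 1) (by norm_cast)
    exact (this.differentiableAt one_ne_zero).clm_apply (differentiableAt_const (1 : ℝ))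
  exact h1.hasDerivAt.mul h2.hasDerivAt

/-- Only the time component differs from `∂ᵢF`; the excess factor `r'² + r r'' - 1` is the one that
appears in `q`. -/
theorem pd_conormal {J : Set ℝ} {r : ℝ → ℝ} (hr : IsAdmissible J r)
    {F : EuclideanSpace ℝ (Fin k) → Fin (n + 2) → ℝ} {x : EuclideanSpace ℝ (Fin k)}
    (hF : DifferentiableAt ℝ F x) (hx : F x 0 ∈ J) :
    DifferentiableAt ℝ (fun y => conormal r (F y)) x ∧ ∀ i,
      pd i (fun y => conormal r (F y)) x = Fin.cons
        ((deriv r (F x 0) ^ 2 + r (F x 0) * deriv (deriv r) (F x 0)) * pd i F x 0)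
        (fun s : Fin (n + 1) => pd i F x s.succ) := by
  have h0 : HasFDerivAt (fun y => conormal r (F y) 0) _ x :=
    (hasDerivAt_mul_deriv hr hx).comp_hasFDerivAt (f := fun y => F y 0) x
      (hasFDerivAt_pi'.1 hF.hasFDerivAt 0)
  have hs : ∀ s : Fin (n + 1), HasFDerivAt (fun y => conormal r (F y) s.succ) _ x :=
    fun s => hasFDerivAt_pi'.1 hF.hasFDerivAt s.succ
  have hd : DifferentiableAt ℝ (fun y => conormal r (F y)) x :=
    differentiableAt_pi.2 (Fin.cases h0.differentiableAt fun s => (hs s).differentiableAt)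
  refine ⟨hd, fun i => funext fun a => ?_⟩
  rw [← pd_apply hd]
  refine Fin.cases ?_ (fun s => ?_) a
  · simp only [pd, h0.fderiv, Fin.cons_zero]
    simp [sq]
  · simp only [pd, (hs s).fderiv, Fin.cons_succ]
    rfl

/-- If the conormal is orthogonal to the immersion near `x`, then the components of its second derivatives
along the conormal are determined by the first derivatives. -/
theorem lorentz_pd_pd_conormal {J : Set ℝ} {r : ℝ → ℝ} (hr : IsAdmissible J r)
    {F : EuclideanSpace ℝ (Fin k) → Fin (n + 2) → ℝ} {x : EuclideanSpace ℝ (Fin k)}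
    (hF : ContDiffAt ℝ 2 F x) (hx : F x 0 ∈ J) (i j : Fin k)
    (ht : ∀ᶠ y in nhds x, lorentz (conormal r (F y)) (pd j F y) = 0) :
    lorentz (pd i (pd j F) x) (conormal r (F x))
      = (deriv (deriv r) (F x 0) * r (F x 0) + deriv r (F x 0) ^ 2 - 1)
          * (pd i F x 0 * pd j F x 0) - coordMetric F x i j := by
  obtain ⟨hd, hpd⟩ := pd_conormal hr (hF.differentiableAt two_ne_zero) hx
  have h := pd_lorentz hd (pd_differentiableAt hF j) i
  have h0 : pd i (fun y => lorentz (conormal r (F y)) (pd j F y)) x = 0 := by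
    have he : (fun y => lorentz (conormal r (F y)) (pd j F y)) =ᶠ[nhds x] fun _ => (0 : ℝ) := ht
    have h1 := congrArg (fun L : EuclideanSpace ℝ (Fin k) →L[ℝ] ℝ =>
      L (EuclideanSpace.single i (1 : ℝ))) he.fderiv_eq
    exact h1.trans (by simp)
  rw [h0, hpd] at h
  rw [lorentz_comm]
  have h2 : lorentz (Fin.cons
        ((deriv r (F x 0) ^ 2 + r (F x 0) * deriv (deriv r) (F x 0)) * pd i F x 0)
        (fun s : Fin (n + 1) => pd i F x s.succ)) (pd j F x)
      = coordMetric F x i j - (deriv (deriv r) (F x 0) * r (F x 0) + deriv r (F x 0) ^ 2 - 1)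
          * (pd i F x 0 * pd j F x 0) := by
    simp only [lorentz, coordMetric, Matrix.of_apply, Fin.cons_zero, Fin.cons_succ]
    ring
  linarith

/-- The Christoffel terms are tangential, so they pair to zero with the conormal; what remains is
the trace of `lorentz_pd_pd_conormal`. -/
theorem lorentz_coordLaplacian_conormal {J : Set ℝ} {r : ℝ → ℝ} (hr : IsAdmissible J r)
    {F : EuclideanSpace ℝ (Fin k) → Fin (n + 2) → ℝ} {x : EuclideanSpace ℝ (Fin k)}
    (hF : ContDiffAt ℝ 2 F x) (hG : IsUnit (coordMetric F x).det) (hx : F x 0 ∈ J)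
    (ht : ∀ᶠ y in nhds x, ∀ j, lorentz (conormal r (F y)) (pd j F y) = 0) :
    lorentz (coordLaplacian (coordMetric F) F x) (conormal r (F x))
      = (deriv (deriv r) (F x 0) * r (F x 0) + deriv r (F x 0) ^ 2 - 1)
          * coordGradSq (coordMetric F) (fun y => F y 0) x - k := by
  have ht0 : ∀ l, lorentz (pd l F x) (conormal r (F x)) = 0 := fun l => by
    rw [lorentz_comm]; exact ht.self_of_nhds l
  rw [lorentz_coordLaplacian, ← sum_inv_mul_coordMetric hG]
  simp only [ht0, mul_zero, Finset.sum_const_zero, sub_zero, coordGradSq,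
    pd_apply (hF.differentiableAt two_ne_zero), Finset.mul_sum, ← Finset.sum_sub_distrib]
  refine Finset.sum_congr rfl fun i _ => Finset.sum_congr rfl fun j _ => ?_
  rw [lorentz_pd_pd_conormal hr hF hx i j (ht.mono fun y hy => hy j)]
  ring

/-- The term `-r² r'²` occurs on both sides of the hypothesis and cancels. -/
theorem mem_rotationHypersurface_of_lorentz_conormal {J : Set ℝ} {r : ℝ → ℝ}
    {y : Fin (n + 2) → ℝ} (hy : y 0 ∈ J)
    (h : lorentz (conormal r y) (conormal r y) = r (y 0) ^ 2 * (1 - deriv r (y 0) ^ 2)) :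
    y ∈ rotationHypersurface n J r := by
  refine ⟨hy, ?_⟩
  simp only [lorentz, conormal, Fin.cons_zero, Fin.cons_succ, ← sq] at h
  linarith

end Coordinates

/-! ### Passage from charts to the manifold -/

section Manifold

variable {k n : ℕ} {M : Type*} [TopologicalSpace M] [ChartedSpace (EuclideanSpace ℝ (Fin k)) M]

theorem mfderiv_eq_fderiv_inChart {Ψ : M → Fin (n + 2) → ℝ} {p : M}
    (h : MDifferentiableAt (𝓡 k) 𝓘(ℝ, Fin (n + 2) → ℝ) Ψ p) :
    mfderiv (𝓡 k) 𝓘(ℝ, Fin (n + 2) → ℝ) Ψ p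
      = fderiv ℝ (inChart p Ψ) (extChartAt (𝓡 k) p p) := by
  rw [h.mfderiv]
  simp only [ModelWithCorners.range_eq_univ, fderivWithin_univ]
  rfl

theorem contDiffAt_inChart [IsManifold (𝓡 k) ∞ M] {Ψ : M → Fin (n + 2) → ℝ}
    (h : ContMDiff (𝓡 k) 𝓘(ℝ, Fin (n + 2) → ℝ) ∞ Ψ) (p : M) :
    ContDiffAt ℝ 2 (inChart p Ψ) (extChartAt (𝓡 k) p p) := by
  have h1 := (contMDiffAt_iff.1 (h p)).2
  simp only [ModelWithCorners.range_eq_univ, contDiffWithinAt_univ] at h1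
  exact h1.of_le (by norm_cast)

/-- The Laplacian at a nearby point is computed in that point's own chart, whereas differentiating
the orthogonality relation needs it throughout the chart at `p`. Passing through `mfderiv` makes the
relation independent of the chart. -/
theorem pd_inChart_eq_mfderiv [IsManifold (𝓡 k) ∞ M] {Ψ : M → Fin (n + 2) → ℝ}
    (h : ContMDiff (𝓡 k) 𝓘(ℝ, Fin (n + 2) → ℝ) ∞ Ψ) (p : M) {y : EuclideanSpace ℝ (Fin k)}
    (hy : y ∈ (extChartAt (𝓡 k) p).target) (i : Fin k) :
    ∃ v : TangentSpace (𝓡 k) ((extChartAt (𝓡 k) p).symm y), pd i (inChart p Ψ) y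
      = mfderiv (𝓡 k) 𝓘(ℝ, Fin (n + 2) → ℝ) Ψ ((extChartAt (𝓡 k) p).symm y) v := by
  have h1 : MDifferentiableAt 𝓘(ℝ, EuclideanSpace ℝ (Fin k)) (𝓡 k) (extChartAt (𝓡 k) p).symm y :=
    ((contMDiffOn_extChartAt_symm (n := ∞) p).contMDiffAt
      ((isOpen_extChartAt_target p).mem_nhds hy)).mdifferentiableAt (by simp)
  have h2 := (h ((extChartAt (𝓡 k) p).symm y)).mdifferentiableAt (by simp)
  have h3 := mfderiv_comp y h2 h1
  rw [mfderiv_eq_fderiv] at h3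
  refine ⟨mfderiv 𝓘(ℝ, EuclideanSpace ℝ (Fin k)) (𝓡 k) (extChartAt (𝓡 k) p).symm y
    (EuclideanSpace.single i (1 : ℝ)), ?_⟩
  exact congrArg (fun L => L (EuclideanSpace.single i (1 : ℝ))) h3

theorem IsSpacelikeImmersion.isUnit_det_coordMetric {Ψ : M → Fin (n + 2) → ℝ}
    (hΨ : IsSpacelikeImmersion (k := k) Ψ) (p : M) :
    IsUnit (coordMetric (inChart p Ψ) (extChartAt (𝓡 k) p p)).det := by
  refine coordMetric_isUnit_det fun v hv => ?_
  have := hΨ.spacelike p v hv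
  rwa [mfderiv_eq_fderiv_inChart ((hΨ.smooth p).mdifferentiableAt (by simp))] at this

theorem inChart_self (Ψ : M → Fin (n + 2) → ℝ) (p : M) :
    inChart p Ψ (extChartAt (𝓡 k) p p) = Ψ p := by
  simp [inChart]

/-- A vector field collinear with the Laplacian of a spacelike immersion is normal to it. -/
theorem lorentz_conormal_mfderiv [IsManifold (𝓡 k) ∞ M] {r : ℝ → ℝ} {Ψ : M → Fin (n + 2) → ℝ}
    (hΨ : IsSpacelikeImmersion (k := k) Ψ) {p : M} {c : ℝ} (hc : c ≠ 0)
    (heq : laplacian (k := k) Ψ Ψ p + c • conormal r (Ψ p) = 0) (v : TangentSpace (𝓡 k) p) :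
    lorentz (n := n) (conormal r (Ψ p)) (mfderiv (𝓡 k) 𝓘(ℝ, Fin (n + 2) → ℝ) Ψ p v) = 0 := by
  have hpd : ∀ m, lorentz (conormal r (Ψ p)) (pd m (inChart p Ψ) (extChartAt (𝓡 k) p p)) = 0 := by
    intro m
    have h := lorentz_coordLaplacian_pd (contDiffAt_inChart hΨ.smooth p)
      (hΨ.isUnit_det_coordMetric p) m
    change lorentz (laplacian Ψ Ψ p) _ = 0 at h
    rw [eq_neg_of_add_eq_zero_left heq, ← neg_smul, lorentz_eq_lorentzForm, map_smul,
      LinearMap.smul_apply, smul_eq_mul] at h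
    exact (mul_eq_zero.1 h).resolve_left (neg_ne_zero.2 hc)
  rw [mfderiv_eq_fderiv_inChart ((hΨ.smooth p).mdifferentiableAt (by simp))]
  have hv := fderiv_eq_sum_pd (inChart p Ψ) (extChartAt (𝓡 k) p p) v
  refine (congrArg (lorentz (conormal r (Ψ p))) hv).trans ?_
  simp only [lorentz_eq_lorentzForm, map_sum, map_smul] at hpd ⊢
  exact Finset.sum_eq_zero fun i _ => by rw [hpd, smul_zero]

/-- A spacelike immersion with `ΔΨ + q P = 0` and `q > 0` is stationary in `Q(r)`. -/
theorem isStationaryInto_of_laplacian_add_smul_conormal [IsManifold (𝓡 k) ∞ M]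
    {J : Set ℝ} {r : ℝ → ℝ} (hr : IsAdmissible J r)
    {Ψ : M → Fin (n + 2) → ℝ} (hΨ : IsSpacelikeImmersion (k := k) Ψ)
    (hJ : ∀ p, Ψ p 0 ∈ J) (hq : ∀ p, 0 < qFun (k := k) r Ψ p)
    (heq : ∀ p, laplacian (k := k) Ψ Ψ p + qFun (k := k) r Ψ p • conormal r (Ψ p) = 0) :
    IsStationaryInto (k := k) J r Ψ := by
  have hnear : ∀ p, ∀ᶠ y in nhds (extChartAt (𝓡 k) p p), ∀ j,
      lorentz (conormal r (inChart p Ψ y)) (pd j (inChart p Ψ) y) = 0 := by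
    intro p
    filter_upwards [extChartAt_target_mem_nhds (I := 𝓡 k) p] with y hy j
    obtain ⟨v, hv⟩ := pd_inChart_eq_mfderiv hΨ.smooth p hy j
    rw [hv]
    exact lorentz_conormal_mfderiv hΨ (hq _).ne' (heq _) v
  have hmem : ∀ p, Ψ p ∈ rotationHypersurface n J r := by
    intro p
    have h := lorentz_coordLaplacian_conormal hr (contDiffAt_inChart hΨ.smooth p)
      (hΨ.isUnit_det_coordMetric p) (by rw [inChart_self]; exact hJ p) (hnear p)
    rw [inChart_self] at h
    change lorentz (laplacian Ψ Ψ p) _ = _ * gradSq Ψ (fun x => Ψ x 0) p - _ at h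
    rw [eq_neg_of_add_eq_zero_left (heq p), ← neg_smul, lorentz_eq_lorentzForm, map_smul,
      LinearMap.smul_apply, smul_eq_mul, ← lorentz_eq_lorentzForm] at h
    have hd := (sq_lt_one_iff_abs_lt_one (deriv r (Ψ p 0))).2 (hr.abs_deriv_lt_one _ (hJ p))
    have hD : r (Ψ p 0) ^ 2 * (1 - deriv r (Ψ p 0) ^ 2) ≠ 0 :=
      (mul_pos (pow_pos (hr.pos _ (hJ p)) 2) (sub_pos.2 hd)).ne'
    have hqD : qFun (k := k) r Ψ p * (r (Ψ p 0) ^ 2 * (1 - deriv r (Ψ p 0) ^ 2)) =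
      (k : ℝ) - (deriv (deriv r) (Ψ p 0) * r (Ψ p 0) + deriv r (Ψ p 0) ^ 2 - 1) *
        gradSq (k := k) Ψ (fun x => Ψ x 0) p := div_mul_cancel₀ _ hD
    -- `h` and `hqD` evaluate `⟨ΔΨ, P⟩` as `-q⟨P, P⟩` and as `-q r²(1 - r'²)`; `q` cancels.
    exact mem_rotationHypersurface_of_lorentz_conormal (hJ p)
      (mul_left_cancel₀ (hq p).ne' (by linarith))
  refine ⟨hΨ, hmem, fun p => ?_⟩
  refine coordMeanCurvature_eq_zero (c := -qFun (k := k) r Ψ p) (hΨ.isUnit_det_coordMetric p) ?_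
    (hnear p).self_of_nhds ?_
  · rw [inChart_self]
    exact (lorentz_conormal_self_pos hr (hmem p)).ne'
  · rw [inChart_self, neg_smul]
    exact eq_neg_of_add_eq_zero_left (heq p)

end Manifold

end SphericalRW

theorem theorem4 {k n : ℕ} {M : Type*} [TopologicalSpace M]
    [ChartedSpace (EuclideanSpace ℝ (Fin k)) M] [IsManifold (𝓡 k) ∞ M]
    (J : Set ℝ) (r : ℝ → ℝ) (hr : SphericalRW.IsAdmissible J r)
    (Ψ : M → Fin (n + 2) → ℝ) (hΨ : SphericalRW.IsSpacelikeImmersion (k := k) Ψ)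
    (hJ : ∀ p, Ψ p 0 ∈ J)
    (hq : ∀ p, 0 < SphericalRW.qFun (k := k) r Ψ p)
    (heq : ∀ p, SphericalRW.laplacian (k := k) Ψ Ψ p
      + SphericalRW.qFun (k := k) r Ψ p • SphericalRW.conormal r (Ψ p) = 0) :
    SphericalRW.IsStationaryInto (k := k) J r Ψ := by
  exact SphericalRW.isStationaryInto_of_laplacian_add_smul_conormal hr hΨ hJ hq heq
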